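/- Let $\lambda_s,\mu_s,\sigma_s,\mu_v,\beta_v,\gamma_v,\sigma_v,\rho_{sv},S_0,V_0$ be real constants, and let $(W_{s,t},W_{v,t})_{t\ge 0}$ be a correlated two-dimensional Brownian motion: each component is a standard real Brownian motion, the pair is a Gaussian process, and $\operatorname{Cov}(W_{s,u},W_{v,t})=\rho_{sv}\min(u,t)$ for all $u,t\ge 0$ (that is, $\operatorname{corr}(dW_{s,t},dW_{v,t})=\rho_{sv}$). Let the processes $(S_t)_{t\ge 0}$ and $(V_t)_{t\ge 0}$, with continuous paths and deterministic initial values $S_0$ and $V_0$, solve $$dS_t=\lambda_s(\mu_s-S_t)\,dt+\sigma_s\,dW_{s,t},\qquad dV_t=\bigl(\mu_v+\beta_v(S_t-\mu_s)^2-\gamma_vV_t\bigr)\,dt+\sigma_v\,dW_{v,t}.$$ Then for every $t\ge 0$ the variables $S_t$, $S_t^2$, $S_t^3$, $V_t$ and $S_tV_t$ are integrable, the integrand below is integrable on $[0,t]$, and $$\mathbb E[S_tV_t]=e^{-(\gamma_v+\lambda_s)t}S_0V_0+\int_0^t e^{(\gamma_v+\lambda_s)(u-t)}\Bigl(\lambda_s\mu_s\,\mathbb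 E[V_u]+\sigma_s\sigma_v\rho_{sv}+[\mu_v+\beta_v\mu_s^2]\,\mathbb E[S_u]-2\beta_v\mu_s\,\mathbb E[S_u^2]+\beta_v\,\mathbb E[S_u^3]\Bigr)\,du .$$ -/

import Mathlib

open MeasureTheory ProbabilityTheory
open scoped NNReal

/-- `(Ws, Wv)` is a two-dimensional Brownian motion whose two components are standard real Brownian
motions with instantaneous correlation `ρ`: the pair is a Gaussian process in the plane and
`Cov(Ws_u, Wv_t) = ρ min(u, t)`. -/
structure IsCorrelatedBrownianPair {Ω : Type*} [MeasurableSpace Ω]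
    (Ws Wv : ℝ≥0 → Ω → ℝ) (ρ : ℝ) (P : Measure Ω) : Prop where
  left : IsBrownianReal Ws P
  right : IsBrownianReal Wv P
  gaussian : IsGaussianProcess (fun (t : ℝ≥0) (ω : Ω) => (Ws t ω, Wv t ω)) P
  covariance_eq : ∀ u t : ℝ≥0, cov[Ws u, Wv t; P] = ρ * (min u t : ℝ≥0)

/-- `(S, V)` solves, with deterministic initial values `s₀` and `v₀`, the system
  `dS_t = lamS (μS - S_t) dt + σS dWs_t`,
  `dV_t = (μV + βV (S_t - μS)² - γV V_t) dt + σV dWv_t`.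
The paths are continuous and the integrated equations hold for all times at once, almost surely.
The diffusion coefficients are constant, so the Itô integral of `σ` is `σ W_t`. -/
structure IsSentimentVolatilitySolution {Ω : Type*} [MeasurableSpace Ω]
    (lamS μS σS μV βV γV σV s₀ v₀ : ℝ)
    (Ws Wv S V : ℝ≥0 → Ω → ℝ) (P : Measure Ω) : Prop where
  continuous_S : ∀ᵐ ω ∂P, Continuous fun t : ℝ≥0 => S t ω
  continuous_V : ∀ᵐ ω ∂P, Continuous fun t : ℝ≥0 => V t ω
  eq_S : ∀ᵐ ω ∂P, ∀ t : ℝ≥0,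
    S t ω = s₀ + (∫ u in (0 : ℝ)..t, lamS * (μS - S u.toNNReal ω)) + σS * Ws t ω
  eq_V : ∀ᵐ ω ∂P, ∀ t : ℝ≥0,
    V t ω = v₀
      + (∫ u in (0 : ℝ)..t,
          (μV + βV * (S u.toNNReal ω - μS) ^ 2 - γV * V u.toNNReal ω))
      + σV * Wv t ω

/-! Formally, Itô's product rule gives `d(SV)` a drift which, in expectation, is `G - (γV + lamS)
E[SV]`, with `G` the bracket of the statement. So `E[SV]` solves a scalar linear equation, and an
integrating factor finishes (`eq_exp_mul_of_eq_add_integral`).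

No stochastic integration is needed, because the diffusion coefficients are constant. Write the
product as `(A + σX)(B + τY)`, with `A`, `B` the absolutely continuous parts, and expand. The term
`AB` obeys the classical product rule. In `XB` and `YA`, increments of a Brownian motion are
independent of the past, so `E[X_t b_u] = E[X_u b_u]` for an adapted rate `b` and `u ≤ t`. The term
`XY` contributes `ρt`. This is `integral_mul_eq_of_orthogonal`.

Adaptedness and moments come from variation of constants: pathwise, `S` is an explicit functional of
`X`, and `V` of `S` and `Y` (`eq_linearSolution`). These functionals use only sums, products and
time integrals, under which `RegularProcess` is stable. Bounded moments then justify every exchange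
of integrals and make the expectations continuous in time. -/

/-! ### Regular processes -/

/-- A real process indexed by `ℝ`, of which only the times `t ≥ 0` matter, that is adapted to `F`,
has continuous paths, and has all its absolute moments bounded on compact time intervals. -/
structure RegularProcess {Ω : Type*} {mΩ : MeasurableSpace Ω} (P : Measure Ω)
    (F : Filtration ℝ mΩ) (Z : ℝ → Ω → ℝ) : Prop where
  adapted : ∀ t, 0 ≤ t → Measurable[F t] (Z t)
  cont : ∀ ω, Continuous fun t => Z t ω
  moment : ∀ (p : ℕ) (T : ℝ), ∃ C : ℝ≥0, ∀ t ∈ Set.Icc 0 T, ∫⁻ ω, ‖Z t ω‖ₑ ^ p ∂P ≤ C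

theorem ENNReal.add_pow_le_two_pow_mul (x y : ENNReal) (p : ℕ) :
    (x + y) ^ p ≤ 2 ^ p * (x ^ p + y ^ p) := by
  rcases le_total x y with h | h
  · calc (x + y) ^ p ≤ (2 * y) ^ p := by rw [two_mul]; gcongr
      _ ≤ _ := by rw [mul_pow]; gcongr; exact le_add_self
  · calc (x + y) ^ p ≤ (2 * x) ^ p := by rw [two_mul]; gcongr
      _ ≤ _ := by rw [mul_pow]; gcongr; exact le_self_add

theorem ENNReal.mul_pow_le_pow_add_pow (x y : ENNReal) (p : ℕ) :
    (x * y) ^ p ≤ x ^ (2 * p) + y ^ (2 * p) := by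
  rcases le_total x y with h | h
  · calc (x * y) ^ p ≤ (y * y) ^ p := by gcongr
      _ ≤ _ := by rw [← sq, ← pow_mul]; exact le_add_self
  · calc (x * y) ^ p ≤ (x * x) ^ p := by gcongr
      _ ≤ _ := by rw [← sq, ← pow_mul]; exact le_self_add

/-- Hölder's inequality against the constant 1, raised to the power `n + 1` so that only natural
exponents remain. -/
theorem MeasureTheory.lintegral_enorm_pow_succ_le {α : Type*} {mα : MeasurableSpace α}
    {μ : Measure α} {f : α → ℝ} (hf : AEStronglyMeasurable f μ) (n : ℕ) :
    (∫⁻ a, ‖f a‖ₑ ∂μ) ^ (n + 1) ≤ (∫⁻ a, ‖f a‖ₑ ^ (n + 1) ∂μ) * μ Set.univ ^ n := by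
  have h := eLpNorm'_le_eLpNorm'_mul_rpow_measure_univ (p := 1) (q := (n + 1 : ℕ)) one_pos
    (by norm_cast; omega) hf
  simp only [eLpNorm', ENNReal.rpow_one, div_one, ENNReal.rpow_natCast] at h
  have hn : ((n + 1 : ℕ) : ℝ) ≠ 0 := by positivity
  calc (∫⁻ a, ‖f a‖ₑ ∂μ) ^ (n + 1) ≤ ((∫⁻ a, ‖f a‖ₑ ^ (n + 1) ∂μ) ^ (1 / ((n + 1 : ℕ) : ℝ)) *
        μ Set.univ ^ (1 - 1 / ((n + 1 : ℕ) : ℝ))) ^ (n + 1) := by gcongr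
    _ = _ := by
      rw [mul_pow]
      congr 1
      · rw [← ENNReal.rpow_natCast, ← ENNReal.rpow_mul, one_div_mul_cancel hn, ENNReal.rpow_one]
      · rw [← ENNReal.rpow_natCast, ← ENNReal.rpow_mul, ← ENNReal.rpow_natCast]
        congr 1
        push_cast at hn ⊢
        field_simp
        ring

namespace RegularProcess

variable {Ω : Type*} {mΩ : MeasurableSpace Ω} {P : Measure Ω} {F : Filtration ℝ mΩ}
  {Z Y : ℝ → Ω → ℝ}

theorem measurable (hZ : RegularProcess P F Z) {t : ℝ} (ht : 0 ≤ t) : Measurable (Z t) :=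
  (hZ.adapted t ht).mono (F.le t) le_rfl

theorem of_continuous [IsProbabilityMeasure P] {f : ℝ → ℝ} (hf : Continuous f) :
    RegularProcess P F fun t _ => f t where
  adapted t _ := measurable_const
  cont _ := hf
  moment p T := by
    obtain ⟨C, hC⟩ := (isCompact_Icc (a := (0 : ℝ)) (b := T)).exists_bound_of_continuousOn
      hf.continuousOn
    refine ⟨C.toNNReal ^ p, fun t ht => ?_⟩
    simp only [lintegral_const, measure_univ, mul_one]
    push_cast
    gcongr
    rw [← ofReal_norm]
    exact ENNReal.ofReal_le_ofReal (hC t ht)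

theorem add (hZ : RegularProcess P F Z) (hY : RegularProcess P F Y) :
    RegularProcess P F fun t ω => Z t ω + Y t ω where
  adapted t ht := (hZ.adapted t ht).add (hY.adapted t ht)
  cont ω := (hZ.cont ω).add (hY.cont ω)
  moment p T := by
    obtain ⟨C, hC⟩ := hZ.moment p T
    obtain ⟨D, hD⟩ := hY.moment p T
    refine ⟨2 ^ p * (C + D), fun t ht => ?_⟩
    have hm : Measurable fun ω => ‖Z t ω‖ₑ ^ p :=
      ((hZ.measurable ht.1).enorm).pow_const p
    calc ∫⁻ ω, ‖Z t ω + Y t ω‖ₑ ^ p ∂P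
        ≤ ∫⁻ ω, 2 ^ p * (‖Z t ω‖ₑ ^ p + ‖Y t ω‖ₑ ^ p) ∂P := by
          refine lintegral_mono fun ω => le_trans ?_ (ENNReal.add_pow_le_two_pow_mul _ _ p)
          gcongr
          exact enorm_add_le _ _
      _ = 2 ^ p * (∫⁻ ω, ‖Z t ω‖ₑ ^ p ∂P + ∫⁻ ω, ‖Y t ω‖ₑ ^ p ∂P) := by
          rw [lintegral_const_mul' _ _ (by simp), lintegral_add_left hm]
      _ ≤ _ := by
          push_cast
          gcongr
          exacts [hC t ht, hD t ht]

theorem mul (hZ : RegularProcess P F Z) (hY : RegularProcess P F Y) :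
    RegularProcess P F fun t ω => Z t ω * Y t ω where
  adapted t ht := (hZ.adapted t ht).mul (hY.adapted t ht)
  cont ω := (hZ.cont ω).mul (hY.cont ω)
  moment p T := by
    obtain ⟨C, hC⟩ := hZ.moment (2 * p) T
    obtain ⟨D, hD⟩ := hY.moment (2 * p) T
    refine ⟨C + D, fun t ht => ?_⟩
    have hm : Measurable fun ω => ‖Z t ω‖ₑ ^ (2 * p) :=
      ((hZ.measurable ht.1).enorm).pow_const _
    calc ∫⁻ ω, ‖Z t ω * Y t ω‖ₑ ^ p ∂P
        ≤ ∫⁻ ω, (‖Z t ω‖ₑ ^ (2 * p) + ‖Y t ω‖ₑ ^ (2 * p)) ∂P := by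
          refine lintegral_mono fun ω => ?_
          rw [enorm_mul]
          exact ENNReal.mul_pow_le_pow_add_pow _ _ p
      _ = ∫⁻ ω, ‖Z t ω‖ₑ ^ (2 * p) ∂P + ∫⁻ ω, ‖Y t ω‖ₑ ^ (2 * p) ∂P := lintegral_add_left hm _
      _ ≤ _ := by
          push_cast
          gcongr
          exacts [hC t ht, hD t ht]

theorem const_mul [IsProbabilityMeasure P] (hZ : RegularProcess P F Z) (c : ℝ) :
    RegularProcess P F fun t ω => c * Z t ω :=
  (of_continuous (f := fun _ => c) continuous_const).mul hZ

theorem pow [IsProbabilityMeasure P] (hZ : RegularProcess P F Z) (n : ℕ) :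
    RegularProcess P F fun t ω => Z t ω ^ n := by
  induction n with
  | zero => simpa using of_continuous (f := fun _ => (1 : ℝ)) continuous_const
  | succ n ih => simpa only [pow_succ] using ih.mul hZ

theorem sub [IsProbabilityMeasure P] (hZ : RegularProcess P F Z) (hY : RegularProcess P F Y) :
    RegularProcess P F fun t ω => Z t ω - Y t ω := by
  simpa [sub_eq_add_neg] using hZ.add (hY.const_mul (-1))

/-- The time at which the process is read can be clamped to `[0, t]`, which makes it jointly
measurable with respect to `F t`. -/
theorem measurable_uncurry_clamp (hZ : RegularProcess P F Z) {t : ℝ} (ht : 0 ≤ t) :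
    Measurable[(inferInstance : MeasurableSpace ℝ).prod (F t)]
      fun q : ℝ × Ω => Z (max 0 (min q.1 t)) q.2 := by
  let _ : MeasurableSpace Ω := F t
  refine measurable_uncurry_of_continuous_of_measurable
    (u := fun (r : ℝ) (ω : Ω) => Z (max 0 (min r t)) ω) (fun ω => ?_) fun r => ?_
  · exact (hZ.cont ω).comp (by fun_prop)
  · exact (hZ.adapted _ (le_max_left _ _)).mono (F.mono (max_le ht (min_le_right _ _))) le_rfl

theorem clamp_eq {t u : ℝ} (hu : u ∈ Set.Ioc 0 t) : max 0 (min u t) = u := by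
  rw [min_eq_left hu.2, max_eq_right hu.1.le]

theorem aestronglyMeasurable_uncurry [SFinite P] (hZ : RegularProcess P F Z) {t : ℝ}
    (ht : 0 ≤ t) :
    AEStronglyMeasurable (fun q : ℝ × Ω => Z q.1 q.2)
      ((volume.restrict (Set.Ioc 0 t)).prod P) := by
  have h1 : Measurable fun q : ℝ × Ω => Z (max 0 (min q.1 t)) q.2 :=
    (hZ.measurable_uncurry_clamp ht).mono (sup_le_sup le_rfl (MeasurableSpace.comap_mono (F.le t)))
      le_rfl
  refine ⟨_, h1.stronglyMeasurable, ?_⟩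
  have h2 : ∀ᵐ u ∂(volume.restrict (Set.Ioc 0 t)), u ∈ Set.Ioc 0 t :=
    ae_restrict_mem measurableSet_Ioc
  filter_upwards [Measure.quasiMeasurePreserving_fst.ae h2] with q hq
  rw [clamp_eq hq]

/-- Adaptedness comes from joint measurability of the clamped process with respect to `F t`, moments
from Hölder in time followed by Tonelli. -/
theorem integral [IsProbabilityMeasure P] (hZ : RegularProcess P F Z) :
    RegularProcess P F fun t ω => ∫ u in (0 : ℝ)..t, Z u ω where
  adapted t ht := by
    have h : (fun ω => ∫ u in (0 : ℝ)..t, Z u ω) =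
        fun ω => ∫ u in Set.Ioc 0 t, Z (max 0 (min u t)) ω := by
      ext ω
      rw [intervalIntegral.integral_of_le ht]
      exact setIntegral_congr_fun measurableSet_Ioc fun u hu => by
        rw [clamp_eq hu]
    rw [h]
    let _ : MeasurableSpace Ω := F t
    exact ((hZ.measurable_uncurry_clamp ht).stronglyMeasurable.integral_prod_left'
      (μ := volume.restrict (Set.Ioc 0 t))).measurable
  cont ω := intervalIntegral.continuous_primitive
    (fun a b => (hZ.cont ω).intervalIntegrable a b) 0
  moment p T := by
    rcases p with _ | n
    · exact ⟨1, fun t ht => by simp⟩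
    obtain ⟨C, hC⟩ := hZ.moment (n + 1) T
    refine ⟨C * T.toNNReal * T.toNNReal ^ n, fun t ht => ?_⟩
    have hvol : volume.restrict (Set.Ioc 0 t) Set.univ ≤ (T.toNNReal : ENNReal) := by
      rw [Measure.restrict_apply_univ, Real.volume_Ioc, sub_zero]
      exact ENNReal.ofReal_le_ofReal ht.2
    have hmeas := hZ.aestronglyMeasurable_uncurry (P := P) ht.1
    calc ∫⁻ ω, ‖∫ u in (0 : ℝ)..t, Z u ω‖ₑ ^ (n + 1) ∂P
        ≤ ∫⁻ ω, (∫⁻ u in Set.Ioc 0 t, ‖Z u ω‖ₑ ^ (n + 1)) * T.toNNReal ^ n ∂P := by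
          refine lintegral_mono fun ω => ?_
          rw [intervalIntegral.integral_of_le ht.1]
          calc _ ≤ (∫⁻ u in Set.Ioc 0 t, ‖Z u ω‖ₑ) ^ (n + 1) := by
                gcongr
                exact enorm_integral_le_lintegral_enorm _
            _ ≤ _ := lintegral_enorm_pow_succ_le (hZ.cont ω).aestronglyMeasurable n
            _ ≤ _ := by gcongr
      _ = (∫⁻ ω, (∫⁻ u in Set.Ioc 0 t, ‖Z u ω‖ₑ ^ (n + 1)) ∂P) * T.toNNReal ^ n := by
          rw [lintegral_mul_const' _ _ (by simp)]
      _ = (∫⁻ u in Set.Ioc 0 t, (∫⁻ ω, ‖Z u ω‖ₑ ^ (n + 1) ∂P)) * T.toNNReal ^ n := by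
          rw [lintegral_lintegral_swap]
          exact (hmeas.prod_swap.enorm.pow_const _)
      _ ≤ (∫⁻ u in Set.Ioc 0 t, C) * T.toNNReal ^ n := by
          gcongr ?_ * _
          exact setLIntegral_mono measurable_const fun u hu => hC u ⟨hu.1.le, hu.2.trans ht.2⟩
      _ ≤ _ := by
          push_cast
          rw [lintegral_const]
          gcongr

theorem integrable [IsProbabilityMeasure P] (hZ : RegularProcess P F Z) {t : ℝ} (ht : 0 ≤ t) :
    Integrable (Z t) P := by
  refine ⟨(hZ.measurable ht).aestronglyMeasurable, ?_⟩
  obtain ⟨C, hC⟩ := hZ.moment 1 t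
  have := hC t ⟨ht, le_rfl⟩
  simp only [pow_one] at this
  exact this.trans_lt ENNReal.coe_lt_top

theorem integrable_uncurry [IsProbabilityMeasure P] (hZ : RegularProcess P F Z) {t : ℝ}
    (ht : 0 ≤ t) :
    Integrable (fun q : ℝ × Ω => Z q.1 q.2) ((volume.restrict (Set.Ioc 0 t)).prod P) := by
  have hm := hZ.aestronglyMeasurable_uncurry (P := P) ht
  refine ⟨hm, ?_⟩
  obtain ⟨C, hC⟩ := hZ.moment 1 t
  simp only [pow_one] at hC
  rw [hasFiniteIntegral_iff_enorm, lintegral_prod _ hm.enorm]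
  calc ∫⁻ u in Set.Ioc 0 t, ∫⁻ ω, ‖Z u ω‖ₑ ∂P ≤ ∫⁻ u in Set.Ioc 0 t, C :=
        setLIntegral_mono measurable_const fun u hu => hC u ⟨hu.1.le, hu.2⟩
    _ < ⊤ := by
        rw [lintegral_const]
        exact ENNReal.mul_lt_top ENNReal.coe_lt_top (by simp)

theorem integral_integral [IsProbabilityMeasure P] (hZ : RegularProcess P F Z) {t : ℝ}
    (ht : 0 ≤ t) :
    ∫ ω, (∫ u in (0 : ℝ)..t, Z u ω) ∂P = ∫ u in (0 : ℝ)..t, ∫ ω, Z u ω ∂P := by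
  simp only [intervalIntegral.integral_of_le ht]
  exact (integral_integral_swap (hZ.integrable_uncurry ht)).symm

/-- The error vanishes when `|x| ≤ M`; otherwise it is at most `|x|`, and `|x| M ≤ x ^ 2`. A second
moment bound thus controls truncation uniformly in time. -/
theorem _root_.abs_sub_clamp_le {M : ℝ} (hM : 0 < M) (x : ℝ) :
    |x - max (-M) (min x M)| ≤ x ^ 2 / M := by
  rw [le_div_iff₀ hM]
  rcases le_total x M with h | h
  · rw [min_eq_left h]
    rcases le_total (-M) x with h' | h'
    · rw [max_eq_right h']; simp; positivity
    · rw [max_eq_left h', abs_of_nonpos (by linarith)]; nlinarith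
  · rw [min_eq_right h, max_eq_right (by linarith), abs_of_nonneg (by linarith)]; nlinarith

/-- Bounded second moments make the expectation continuous along continuous paths. -/
theorem continuousOn_integral [IsProbabilityMeasure P] (hZ : RegularProcess P F Z) (T : ℝ) :
    ContinuousOn (fun t => ∫ ω, Z t ω ∂P) (Set.Icc 0 T) := by
  obtain ⟨C, hC⟩ := hZ.moment 2 T
  have hsq : ∀ t ∈ Set.Icc 0 T, ∫ ω, Z t ω ^ 2 ∂P ≤ C := fun t ht => by
    rw [integral_eq_lintegral_of_nonneg_ae (ae_of_all _ fun ω => sq_nonneg _)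
      ((hZ.pow 2).measurable ht.1).aestronglyMeasurable]
    refine ENNReal.toReal_le_coe_of_le_coe ?_
    refine le_trans (le_of_eq (lintegral_congr fun ω => ?_)) (hC t ht)
    rw [← sq_abs, ENNReal.ofReal_pow (abs_nonneg _), ← Real.norm_eq_abs, ofReal_norm]
  have hmeas : ∀ n : ℕ, ∀ t ∈ Set.Icc 0 T,
      Measurable fun ω => max (-(n + 1 : ℝ)) (min (Z t ω) (n + 1)) := fun n t ht =>
    measurable_const.max ((hZ.measurable ht.1).min measurable_const)
  have hbd : ∀ n : ℕ, ∀ x : ℝ, ‖max (-(n + 1 : ℝ)) (min x (n + 1))‖ ≤ n + 1 := fun n x => by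
    have : (0 : ℝ) ≤ n := by positivity
    rw [Real.norm_eq_abs, abs_le]
    exact ⟨le_max_left _ _, max_le (by linarith) (min_le_right _ _)⟩
  -- Truncated means are continuous by dominated convergence. They converge uniformly at rate `C /
  -- (n + 1)`, so the limit is continuous; the level `n + 1` is never zero.
  have hcont : ∀ n : ℕ, ContinuousOn
      (fun t => ∫ ω, max (-(n + 1 : ℝ)) (min (Z t ω) (n + 1)) ∂P) (Set.Icc 0 T) := fun n =>
    continuousOn_of_dominated (fun t ht => (hmeas n t ht).aestronglyMeasurable)
      (bound := fun _ => (n + 1 : ℝ)) (fun t _ => ae_of_all _ fun ω => hbd n _)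
      (integrable_const _)
      (ae_of_all _ fun ω => (continuous_const.max
        ((hZ.cont ω).min continuous_const)).continuousOn)
  have hunif : TendstoUniformlyOn
      (fun (n : ℕ) t => ∫ ω, max (-(n + 1 : ℝ)) (min (Z t ω) (n + 1)) ∂P)
      (fun t => ∫ ω, Z t ω ∂P) Filter.atTop (Set.Icc 0 T) := by
    rw [Metric.tendstoUniformlyOn_iff]
    intro ε hε
    have hlim : Filter.Tendsto (fun n : ℕ => (C : ℝ) / (n + 1)) Filter.atTop (nhds 0) :=
      tendsto_const_div_atTop_nhds_zero_nat (C : ℝ) |>.comp (Filter.tendsto_add_atTop_nat 1)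
        |>.congr fun n => by simp
    filter_upwards [hlim.eventually_lt_const hε] with n hn t ht
    refine lt_of_le_of_lt ?_ hn
    have hpos : (0 : ℝ) < n + 1 := by positivity
    have hint : Integrable (fun ω => max (-(n + 1 : ℝ)) (min (Z t ω) (n + 1))) P :=
      Integrable.of_bound (hmeas n t ht).aestronglyMeasurable (n + 1)
        (ae_of_all _ fun ω => hbd n _)
    rw [Real.dist_eq, ← integral_sub (hZ.integrable ht.1) hint]
    calc |∫ ω, (Z t ω - max (-(n + 1 : ℝ)) (min (Z t ω) (n + 1))) ∂P|
        ≤ ∫ ω, |Z t ω - max (-(n + 1 : ℝ)) (min (Z t ω) (n + 1))| ∂P :=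
          abs_integral_le_integral_abs
      _ ≤ ∫ ω, Z t ω ^ 2 / (n + 1) ∂P :=
          integral_mono (((hZ.integrable ht.1).sub hint).abs) (((hZ.pow 2).integrable ht.1).div_const _)
            fun ω => abs_sub_clamp_le hpos _
      _ ≤ C / (n + 1) := by
          rw [integral_div]
          gcongr
          exact hsq t ht
  exact hunif.continuousOn (Filter.Frequently.of_forall hcont)

end RegularProcess

/-! ### Linear integral equations -/

theorem eq_exp_mul_of_eq_add_integral {k m₀ T : ℝ} (hT : 0 ≤ T) {g m : ℝ → ℝ}
    (hg : ContinuousOn g (Set.Icc 0 T)) (hm : ContinuousOn m (Set.Icc 0 T))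
    (h : ∀ t ∈ Set.Icc 0 T, m t = m₀ + ∫ u in (0 : ℝ)..t, (g u - k * m u)) :
    m T = Real.exp (-k * T) * (m₀ + ∫ u in (0 : ℝ)..T, Real.exp (k * u) * g u) := by
  have hd : ContinuousOn (fun u => g u - k * m u) (Set.Icc 0 T) :=
    hg.sub (continuousOn_const.mul hm)
  have hexp : Continuous fun u : ℝ => Real.exp (k * u) := by fun_prop
  have hder : ∀ t ∈ Set.Ioo 0 T,
      HasDerivAt (fun u => Real.exp (k * u) * m u) (Real.exp (k * t) * g t) t := by
    intro t ht
    have h1 : HasDerivAt (fun s => ∫ u in (0 : ℝ)..s, (g u - k * m u)) (g t - k * m t) t := by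
      refine intervalIntegral.integral_hasDerivAt_right ?_ ?_ ?_
      · refine ContinuousOn.intervalIntegrable ?_
        rw [Set.uIcc_of_le ht.1.le]
        exact hd.mono (Set.Icc_subset_Icc_right ht.2.le)
      · exact (hd.mono Set.Ioo_subset_Icc_self).stronglyMeasurableAtFilter isOpen_Ioo t ht
      · exact hd.continuousAt (Icc_mem_nhds ht.1 ht.2)
    have h2 : HasDerivAt m (g t - k * m t) t := by
      refine (h1.const_add m₀).congr_of_eventuallyEq ?_
      filter_upwards [Icc_mem_nhds ht.1 ht.2] with s hs using h s hs
    have h3 : HasDerivAt (fun u => Real.exp (k * u)) (Real.exp (k * t) * (k * 1)) t :=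
      ((hasDerivAt_id t).const_mul k).exp
    exact (h3.mul h2).congr_deriv (by ring)
  have hftc := intervalIntegral.integral_eq_sub_of_hasDerivAt_of_le hT
    (hexp.continuousOn.mul hm) hder
    (ContinuousOn.intervalIntegrable (by
      rw [Set.uIcc_of_le hT]
      exact hexp.continuousOn.mul hg))
  have h0 : m 0 = m₀ := by simpa using h 0 ⟨le_rfl, hT⟩
  rw [hftc]
  simp only [Pi.mul_apply, h0, mul_zero, Real.exp_zero, one_mul, add_sub_cancel, ← mul_assoc, ← Real.exp_add]
  simp

/-- The explicit solution of `dx = (f - k x) dt + σ dw`, `x 0 = x₀`. -/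
noncomputable def linearSolution (k x₀ σ : ℝ) (f w : ℝ → ℝ) (t : ℝ) : ℝ :=
  Real.exp (-k * t) * (x₀ + ∫ u in (0 : ℝ)..t, Real.exp (k * u) * (f u - k * σ * w u)) + σ * w t

/-- The path `w` need not be differentiable, but `x - σ w` is, in the interior, and it solves the
noiseless equation with source `f - k σ w`. -/
theorem eq_linearSolution {k x₀ σ T : ℝ} (hT : 0 ≤ T) {f w x : ℝ → ℝ}
    (hf : Continuous f) (hw : Continuous w) (hx : Continuous x)
    (h : ∀ t, 0 ≤ t → x t = x₀ + (∫ u in (0 : ℝ)..t, (f u - k * x u)) + σ * w t) :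
    x T = linearSolution k x₀ σ f w T := by
  have := eq_exp_mul_of_eq_add_integral (k := k) (m₀ := x₀) hT
    (g := fun u => f u - k * σ * w u) (m := fun u => x u - σ * w u)
    (by fun_prop) (by fun_prop) fun t ht => by
      rw [h t ht.1, add_sub_cancel_right]
      congr 2
      ext u
      ring
  rw [linearSolution, ← this]
  ring

theorem RegularProcess.linearSolution {Ω : Type*} {mΩ : MeasurableSpace Ω} {P : Measure Ω}
    [IsProbabilityMeasure P] {F : Filtration ℝ mΩ} {f W : ℝ → Ω → ℝ}
    (hf : RegularProcess P F f) (hW : RegularProcess P F W) (k x₀ σ : ℝ) :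
    RegularProcess P F fun t ω => linearSolution k x₀ σ (fun u => f u ω) (fun u => W u ω) t := by
  have h1 : RegularProcess P F fun u ω => Real.exp (k * u) * (f u ω - k * σ * W u ω) :=
    (RegularProcess.of_continuous (f := fun u => Real.exp (k * u)) (by fun_prop)).mul
      (hf.sub (hW.const_mul (k * σ)))
  exact ((RegularProcess.of_continuous (f := fun t => Real.exp (-k * t)) (by fun_prop)).mul
    ((RegularProcess.of_continuous (f := fun _ => x₀) continuous_const).add h1.integral)).add
      (hW.const_mul σ)

/-! ### Expectation of a product of two Itô processes with constant diffusion coefficients -/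

namespace RegularProcess

variable {Ω : Type*} {mΩ : MeasurableSpace Ω} {P : Measure Ω} {F : Filtration ℝ mΩ}
  {a b X Y Z : ℝ → Ω → ℝ}

theorem const_filtration (hZ : RegularProcess P F Z) :
    RegularProcess P (Filtration.const ℝ mΩ le_rfl) Z where
  adapted _ ht := hZ.measurable ht
  cont := hZ.cont
  moment := hZ.moment

/-- A value at time `t` is not adapted at earlier times. Fubini needs only measurability and
moments, so the filtration is replaced by the constant one. -/
theorem frozen (hZ : RegularProcess P F Z) {t : ℝ} (ht : 0 ≤ t) :
    RegularProcess P (Filtration.const ℝ mΩ le_rfl) fun _ => Z t where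
  adapted _ _ := hZ.measurable ht
  cont _ := continuous_const
  moment p _ := (hZ.moment p t).imp fun _ hC _ _ => hC t ⟨ht, le_rfl⟩

variable [IsProbabilityMeasure P]

theorem intervalIntegrable_integral (hZ : RegularProcess P F Z) {t : ℝ} (ht : 0 ≤ t) :
    IntervalIntegrable (fun u => ∫ ω, Z u ω ∂P) volume 0 t := by
  refine ContinuousOn.intervalIntegrable ?_
  rw [Set.uIcc_of_le ht]
  exact hZ.continuousOn_integral t

theorem _root_.add_integral_mul_add_integral {f g : ℝ → ℝ} (hf : Continuous f)
    (hg : Continuous g) (x y t : ℝ) :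
    (x + ∫ u in (0 : ℝ)..t, f u) * (y + ∫ u in (0 : ℝ)..t, g u) =
      x * y + ∫ u in (0 : ℝ)..t,
        (f u * (y + ∫ r in (0 : ℝ)..u, g r) + (x + ∫ r in (0 : ℝ)..u, f r) * g u) := by
  have hf' : ∀ u, HasDerivAt (fun s => x + ∫ r in (0 : ℝ)..s, f r) (f u) u := fun u =>
    (hf.integral_hasStrictDerivAt 0 u).hasDerivAt.const_add x
  have hg' : ∀ u, HasDerivAt (fun s => y + ∫ r in (0 : ℝ)..s, g r) (g u) u := fun u =>
    (hg.integral_hasStrictDerivAt 0 u).hasDerivAt.const_add y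
  rw [intervalIntegral.integral_deriv_mul_eq_sub (fun u _ => hf' u) (fun u _ => hg' u)
    (hf.intervalIntegrable _ _) (hg.intervalIntegrable _ _)]
  simp

/-- If the increments of `X` are orthogonal to the past of `b`, then
`E[X_t (y + ∫₀ᵗ b)] = ∫₀ᵗ E[X_u b_u] du`. -/
theorem integral_mul_add_integral (hb : RegularProcess P F b) (hX : RegularProcess P F X)
    (hX0 : ∀ t, 0 ≤ t → ∫ ω, X t ω ∂P = 0)
    (hXb : ∀ u t, 0 ≤ u → u ≤ t → ∫ ω, (X t ω - X u ω) * b u ω ∂P = 0)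
    (y : ℝ) {t : ℝ} (ht : 0 ≤ t) :
    ∫ ω, X t ω * (y + ∫ u in (0 : ℝ)..t, b u ω) ∂P =
      ∫ u in (0 : ℝ)..t, ∫ ω, X u ω * b u ω ∂P := by
  have hXtb := (hX.frozen ht).mul hb.const_filtration
  have h1 : ∀ ω, X t ω * (y + ∫ u in (0 : ℝ)..t, b u ω) =
      X t ω * y + ∫ u in (0 : ℝ)..t, X t ω * b u ω := fun ω => by
    rw [intervalIntegral.integral_const_mul, mul_add]
  simp only [h1]
  rw [integral_add ((hX.integrable ht).mul_const y) (hXtb.integral.integrable ht),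
    integral_mul_const, hX0 t ht, zero_mul, zero_add, hXtb.integral_integral ht]
  refine intervalIntegral.integral_congr fun u hu => ?_
  rw [Set.uIcc_of_le ht] at hu
  have := hXb u t hu.1 hu.2
  simp only [sub_mul] at this
  rw [integral_sub (hXtb.integrable hu.1) ((hX.mul hb).integrable hu.1)] at this
  exact sub_eq_zero.1 this

/-- Itô's product formula in expectation. Both sides are expanded into the same four pieces: drift
with drift, two mixed terms, noise with noise. -/
theorem integral_mul_eq_of_orthogonal (ha : RegularProcess P F a) (hb : RegularProcess P F b)
    (hX : RegularProcess P F X) (hY : RegularProcess P F Y)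
    (hX0 : ∀ t, 0 ≤ t → ∫ ω, X t ω ∂P = 0) (hY0 : ∀ t, 0 ≤ t → ∫ ω, Y t ω ∂P = 0)
    (hXb : ∀ u t, 0 ≤ u → u ≤ t → ∫ ω, (X t ω - X u ω) * b u ω ∂P = 0)
    (hYa : ∀ u t, 0 ≤ u → u ≤ t → ∫ ω, (Y t ω - Y u ω) * a u ω ∂P = 0)
    {ρ : ℝ} (hXY : ∀ t, 0 ≤ t → ∫ ω, X t ω * Y t ω ∂P = ρ * t) (x y σ τ : ℝ)
    {t : ℝ} (ht : 0 ≤ t) :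
    ∫ ω, (x + (∫ u in (0 : ℝ)..t, a u ω) + σ * X t ω) *
        (y + (∫ u in (0 : ℝ)..t, b u ω) + τ * Y t ω) ∂P =
      x * y + ∫ u in (0 : ℝ)..t,
        (∫ ω, (a u ω * (y + (∫ r in (0 : ℝ)..u, b r ω) + τ * Y u ω) +
          (x + (∫ r in (0 : ℝ)..u, a r ω) + σ * X u ω) * b u ω) ∂P + σ * τ * ρ) := by
  have hA : RegularProcess P F fun t ω => x + ∫ u in (0 : ℝ)..t, a u ω :=
    (of_continuous (f := fun _ => x) continuous_const).add ha.integral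
  have hB : RegularProcess P F fun t ω => y + ∫ u in (0 : ℝ)..t, b u ω :=
    (of_continuous (f := fun _ => y) continuous_const).add hb.integral
  have hD := (ha.mul hB).add (hA.mul hb)
  have hAB : ∫ ω, (x + ∫ u in (0 : ℝ)..t, a u ω) * (y + ∫ u in (0 : ℝ)..t, b u ω) ∂P =
      x * y + ∫ u in (0 : ℝ)..t, ∫ ω, (a u ω * (y + ∫ r in (0 : ℝ)..u, b r ω) +
        (x + ∫ r in (0 : ℝ)..u, a r ω) * b u ω) ∂P := by
    simp only [fun ω => add_integral_mul_add_integral (ha.cont ω) (hb.cont ω) x y t]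
    rw [integral_add (integrable_const _) (hD.integral.integrable ht), hD.integral_integral ht]
    simp
  have hXB := integral_mul_add_integral hb hX hX0 hXb y ht
  have hYA := integral_mul_add_integral ha hY hY0 hYa x ht
  have hL : ∀ ω, (x + (∫ u in (0 : ℝ)..t, a u ω) + σ * X t ω) *
        (y + (∫ u in (0 : ℝ)..t, b u ω) + τ * Y t ω) =
      (x + ∫ u in (0 : ℝ)..t, a u ω) * (y + ∫ u in (0 : ℝ)..t, b u ω) +
        (σ * (X t ω * (y + ∫ u in (0 : ℝ)..t, b u ω)) +
        (τ * (Y t ω * (x + ∫ u in (0 : ℝ)..t, a u ω)) + σ * τ * (X t ω * Y t ω))) :=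
    fun ω => by ring
  have hR : ∀ u ∈ Set.uIcc 0 t,
      (∫ ω, (a u ω * (y + (∫ r in (0 : ℝ)..u, b r ω) + τ * Y u ω) +
          (x + (∫ r in (0 : ℝ)..u, a r ω) + σ * X u ω) * b u ω) ∂P + σ * τ * ρ) =
      (∫ ω, (a u ω * (y + ∫ r in (0 : ℝ)..u, b r ω) +
        (x + ∫ r in (0 : ℝ)..u, a r ω) * b u ω) ∂P) + (σ * (∫ ω, X u ω * b u ω ∂P) +
        (τ * (∫ ω, Y u ω * a u ω ∂P) + σ * τ * ρ)) := fun u hu => by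
    rw [Set.uIcc_of_le ht] at hu
    have : ∀ ω, a u ω * (y + (∫ r in (0 : ℝ)..u, b r ω) + τ * Y u ω) +
          (x + (∫ r in (0 : ℝ)..u, a r ω) + σ * X u ω) * b u ω =
        (a u ω * (y + ∫ r in (0 : ℝ)..u, b r ω) + (x + ∫ r in (0 : ℝ)..u, a r ω) * b u ω) +
        (σ * (X u ω * b u ω) + τ * (Y u ω * a u ω)) := fun ω => by ring
    simp only [this]
    have i1 := ((hX.mul hb).const_mul σ).integrable hu.1
    have i2 := ((hY.mul ha).const_mul τ).integrable hu.1
    rw [integral_add (hD.integrable hu.1) (i1.fun_add i2), integral_add i1 i2, integral_const_mul,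
      integral_const_mul]
    ring
  rw [intervalIntegral.integral_congr hR]
  simp only [hL]
  have i1 := ((hX.mul hB).const_mul σ).integrable ht
  have i2 := ((hY.mul hA).const_mul τ).integrable ht
  have i3 := ((hX.mul hY).const_mul (σ * τ)).integrable ht
  have j1 := ((hX.mul hb).intervalIntegrable_integral ht).const_mul σ
  have j2 := ((hY.mul ha).intervalIntegrable_integral ht).const_mul τ
  have j3 : IntervalIntegrable (fun _ => σ * τ * ρ) volume 0 t := intervalIntegrable_const
  rw [integral_add ((hA.mul hB).integrable ht) (i1.fun_add (i2.fun_add i3)), integral_add i1 (i2.fun_add i3),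
    integral_add i2 i3, integral_const_mul, integral_const_mul, integral_const_mul, hAB, hXB, hYA,
    hXY t ht, intervalIntegral.integral_add (hD.intervalIntegrable_integral ht)
      (j1.add (j2.add j3)), intervalIntegral.integral_add j1 (j2.add j3),
    intervalIntegral.integral_add j2 j3, intervalIntegral.integral_const_mul,
    intervalIntegral.integral_const_mul, intervalIntegral.integral_const]
  simp only [sub_zero, smul_eq_mul]
  ring

end RegularProcess

/-! ### Continuous modifications -/

/-- A continuous path is determined by its values on a dense sequence. On one measurable set of full
measure the path is continuous and these values agree with measurable versions; elsewhere the path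
is set to zero. -/
theorem exists_continuous_measurable_modification {Ω : Type*} {mΩ : MeasurableSpace Ω}
    {P : Measure Ω} {W : ℝ≥0 → Ω → ℝ} (hm : ∀ t, AEMeasurable (W t) P)
    (hc : ∀ᵐ ω ∂P, Continuous fun t => W t ω) :
    ∃ X : ℝ≥0 → Ω → ℝ, (∀ t, Measurable (X t)) ∧ (∀ ω, Continuous fun t => X t ω) ∧
      ∀ᵐ ω ∂P, ∀ t, W t ω = X t ω := by
  classical
  let d := TopologicalSpace.denseSeq ℝ≥0
  have hgood : ∀ᵐ ω ∂P, (Continuous fun t => W t ω) ∧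
      ∀ n, W (d n) ω = (hm (d n)).mk _ ω :=
    hc.and (ae_all_iff.2 fun n => (hm (d n)).ae_eq_mk)
  obtain ⟨G, hG, hGm, hGs⟩ := hgood.exists_measurable_mem
  refine ⟨fun t => G.indicator (W t), fun t => ?_, fun ω => ?_, ?_⟩
  · have ht : t ∈ closure (Set.range d) := TopologicalSpace.denseRange_denseSeq ℝ≥0 t
    obtain ⟨q, hq, hqt⟩ := mem_closure_iff_seq_limit.1 ht
    choose n hn using hq
    refine measurable_of_tendsto_metrizable
      (f := fun i => G.indicator ((hm (d (n i))).mk _))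
      (fun i => ((hm (d (n i))).measurable_mk).indicator hGm) ?_
    rw [tendsto_pi_nhds]
    intro ω
    by_cases hω : ω ∈ G
    · simp only [Set.indicator_of_mem hω]
      refine (((hGs ω hω).1.tendsto t).comp hqt).congr fun i => ?_
      rw [← (hGs ω hω).2, hn]
      rfl
    · simp [Set.indicator_of_notMem hω]
  · by_cases hω : ω ∈ G
    · simpa only [Set.indicator_of_mem hω] using (hGs ω hω).1
    · simpa only [Set.indicator_of_notMem hω] using continuous_const
  · filter_upwards [hG] with ω hω t
    rw [Set.indicator_of_mem hω]

/-! ### Pairs of correlated Brownian motions -/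

/-- The values up to time `t` of a pair of processes. -/
def pastOfPair {Ω : Type*} (X Y : ℝ≥0 → Ω → ℝ) (t : ℝ≥0) (ω : Ω)
    (i : Set.Iic t ⊕ Set.Iic t) : ℝ :=
  Sum.elim (fun r : Set.Iic t => X r ω) (fun r : Set.Iic t => Y r ω) i

theorem measurable_pastOfPair {Ω : Type*} {mΩ : MeasurableSpace Ω} {X Y : ℝ≥0 → Ω → ℝ}
    (hX : ∀ t, Measurable (X t)) (hY : ∀ t, Measurable (Y t)) (t : ℝ≥0) :
    Measurable (pastOfPair X Y t) := by
  refine measurable_pi_lambda _ fun i => ?_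
  rcases i with i | i
  exacts [hX i, hY i]

/-- The filtration generated by a pair of processes. -/
def filtrationOfPair {Ω : Type*} {mΩ : MeasurableSpace Ω} (X Y : ℝ≥0 → Ω → ℝ)
    (hX : ∀ t, Measurable (X t)) (hY : ∀ t, Measurable (Y t)) : Filtration ℝ mΩ where
  seq t := MeasurableSpace.comap (pastOfPair X Y t.toNNReal) inferInstance
  mono' s t hst := by
    have hst' : s.toNNReal ≤ t.toNNReal := Real.toNNReal_mono hst
    let φ (g : Set.Iic t.toNNReal ⊕ Set.Iic t.toNNReal → ℝ)
        (i : Set.Iic s.toNNReal ⊕ Set.Iic s.toNNReal) : ℝ :=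
      g (Sum.map (Set.inclusion (Set.Iic_subset_Iic.2 hst'))
        (Set.inclusion (Set.Iic_subset_Iic.2 hst')) i)
    have hφ : Measurable φ := measurable_pi_lambda _ fun i => measurable_pi_apply _
    have h : pastOfPair X Y s.toNNReal = φ ∘ pastOfPair X Y t.toNNReal := by
      ext ω i
      rcases i with i | i <;> rfl
    change MeasurableSpace.comap _ _ ≤ MeasurableSpace.comap _ _
    rw [h, ← MeasurableSpace.comap_comp]
    exact MeasurableSpace.comap_mono hφ.comap_le
  le' t := (measurable_pastOfPair hX hY _).comap_le

namespace IsCorrelatedBrownianPair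

variable {Ω : Type*} {mΩ : MeasurableSpace Ω} {P : Measure Ω} {X Y : ℝ≥0 → Ω → ℝ} {ρ : ℝ}

theorem congr {Ws Wv : ℝ≥0 → Ω → ℝ} (hW : IsCorrelatedBrownianPair Ws Wv ρ P)
    (hXc : ∀ ω, Continuous fun t => X t ω) (hYc : ∀ ω, Continuous fun t => Y t ω)
    (hX : ∀ t, Ws t =ᵐ[P] X t) (hY : ∀ t, Wv t =ᵐ[P] Y t) :
    IsCorrelatedBrownianPair X Y ρ P where
  left := ⟨hW.left.toIsPreBrownianReal.congr hX, ae_of_all _ hXc⟩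
  right := ⟨hW.right.toIsPreBrownianReal.congr hY, ae_of_all _ hYc⟩
  gaussian := hW.gaussian.congr fun t => by
    filter_upwards [hX t, hY t] with ω h1 h2
    rw [h1, h2]
  covariance_eq u t := by
    rw [← hW.covariance_eq]
    simp only [covariance]
    rw [integral_congr_ae (hX u), integral_congr_ae (hY t)]
    refine integral_congr_ae ?_
    filter_upwards [hX u, hY t] with ω h1 h2
    rw [h1, h2]

theorem swap (h : IsCorrelatedBrownianPair X Y ρ P) : IsCorrelatedBrownianPair Y X ρ P where
  left := h.right
  right := h.left
  gaussian := h.gaussian.comp_left fun _ =>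
    (ContinuousLinearMap.snd ℝ ℝ ℝ).prod (ContinuousLinearMap.fst ℝ ℝ ℝ)
  covariance_eq u t := by rw [covariance_comm, h.covariance_eq, min_comm]

theorem memLp_left (h : IsCorrelatedBrownianPair X Y ρ P) (t : ℝ≥0) : MemLp (X t) 2 P :=
  (h.left.hasLaw_eval t).hasGaussianLaw.memLp_two

theorem integral_mul (h : IsCorrelatedBrownianPair X Y ρ P) [IsProbabilityMeasure P] (t : ℝ≥0) :
    ∫ ω, X t ω * Y t ω ∂P = ρ * t := by
  have := h.covariance_eq t t
  rw [covariance_eq_sub (h.memLp_left t) (h.swap.memLp_left t), h.left.integral_eval,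
    zero_mul, sub_zero, min_self] at this
  simpa using this

/-- Increments are independent of the past of the pair. -/
theorem indepFun_sub_pastOfPair (h : IsCorrelatedBrownianPair X Y ρ P) [IsProbabilityMeasure P]
    {u t : ℝ≥0} (hut : u ≤ t) :
    IndepFun (fun ω => X t ω - X u ω) (pastOfPair X Y u) P := by
  have hX := h.memLp_left
  have hY := h.swap.memLp_left
  let D : Unit → Ω → ℝ := fun _ ω => X t ω - X u ω
  let Q : Set.Iic u ⊕ Set.Iic u → Ω → ℝ := fun i ω => pastOfPair X Y u ω i
  have hD : ∀ i, MemLp (D i) 2 P := fun _ => (hX t).sub (hX u)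
  have hQ : ∀ i, MemLp (Q i) 2 P := by
    rintro (i | i)
    exacts [hX i, hY i]
  -- Each coordinate is a linear function of finitely many values of the pair, so increment and past
  -- are jointly Gaussian and zero covariance suffices for independence. For `i ≤ u ≤ t` the two
  -- minima in the covariance are both `i` and cancel.
  have hG : IsGaussianProcess (Sum.elim D Q) P := by
    classical
    apply IsGaussianProcess.of_isGaussianProcess h.gaussian
    rintro (i | i | i)
    · exact ⟨{t, u}, (ContinuousLinearMap.fst ℝ ℝ ℝ).comp
        (ContinuousLinearMap.proj ⟨t, by simp⟩ - ContinuousLinearMap.proj ⟨u, by simp⟩),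
        fun ω => by simp [D]⟩
    · exact ⟨{i.1}, (ContinuousLinearMap.fst ℝ ℝ ℝ).comp (ContinuousLinearMap.proj ⟨i.1, by simp⟩),
        fun ω => by simp [Q, pastOfPair]⟩
    · exact ⟨{i.1}, (ContinuousLinearMap.snd ℝ ℝ ℝ).comp (ContinuousLinearMap.proj ⟨i.1, by simp⟩),
        fun ω => by simp [Q, pastOfPair]⟩
  have hI : IndepFun (fun ω i => D i ω) (fun ω i => Q i ω) P := by
    refine hG.indepFun_of_covariance_eq_zero (fun i => (hD i).aemeasurable)
      (fun i => (hQ i).aemeasurable) ?_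
    rintro - (⟨i, hi⟩ | ⟨i, hi⟩)
    · have hi' : i ≤ u := hi
      change cov[fun ω => X t ω - X u ω, X i; P] = 0
      rw [covariance_fun_sub_left (hX t) (hX u) (hX i), h.left.covariance_eval,
        h.left.covariance_eval, min_eq_right hi', min_eq_right (hi'.trans hut), sub_self]
    · have hi' : i ≤ u := hi
      change cov[fun ω => X t ω - X u ω, Y i; P] = 0
      rw [covariance_fun_sub_left (hX t) (hX u) (hY i), h.covariance_eq,
        h.covariance_eq, min_eq_right hi', min_eq_right (hi'.trans hut), sub_self]
  exact hI.comp (measurable_pi_apply ()) measurable_id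

theorem integral_sub_mul_eq_zero (h : IsCorrelatedBrownianPair X Y ρ P) [IsProbabilityMeasure P]
    (hX : ∀ t, Measurable (X t)) (hY : ∀ t, Measurable (Y t)) {b : ℝ → Ω → ℝ}
    (hb : RegularProcess P (filtrationOfPair X Y hX hY) b) {u t : ℝ} (hu : 0 ≤ u) (hut : u ≤ t) :
    ∫ ω, (X t.toNNReal ω - X u.toNNReal ω) * b u ω ∂P = 0 := by
  have hI := h.indepFun_sub_pastOfPair (Real.toNNReal_mono hut)
  have hI' : IndepFun (fun ω => X t.toNNReal ω - X u.toNNReal ω) (b u) P := by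
    rw [IndepFun_iff_Indep] at hI ⊢
    exact indep_of_indep_of_le_right hI (hb.adapted u hu).comap_le
  rw [hI'.integral_fun_mul_eq_mul_integral ((hX _).sub (hX _)).aestronglyMeasurable
    (hb.measurable hu).aestronglyMeasurable, integral_sub (h.left.integrable_eval _)
    (h.left.integrable_eval _), h.left.integral_eval, h.left.integral_eval]
  simp

end IsCorrelatedBrownianPair

/-- Reordering coordinates is measurable. This transfers results about the first component to the
second. -/
theorem filtrationOfPair_swap_le {Ω : Type*} {mΩ : MeasurableSpace Ω} {X Y : ℝ≥0 → Ω → ℝ}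
    (hX : ∀ t, Measurable (X t)) (hY : ∀ t, Measurable (Y t)) (t : ℝ) :
    filtrationOfPair X Y hX hY t ≤ filtrationOfPair Y X hY hX t := by
  let φ (g : Set.Iic t.toNNReal ⊕ Set.Iic t.toNNReal → ℝ)
      (i : Set.Iic t.toNNReal ⊕ Set.Iic t.toNNReal) : ℝ := g i.swap
  have hφ : Measurable φ := measurable_pi_lambda _ fun i => measurable_pi_apply _
  have h : pastOfPair X Y t.toNNReal = φ ∘ pastOfPair Y X t.toNNReal := by
    ext ω i
    rcases i with i | i <;> rfl
  change MeasurableSpace.comap _ _ ≤ MeasurableSpace.comap _ _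
  rw [h, ← MeasurableSpace.comap_comp]
  exact MeasurableSpace.comap_mono hφ.comap_le

theorem RegularProcess.mono {Ω : Type*} {mΩ : MeasurableSpace Ω} {P : Measure Ω}
    {F G : Filtration ℝ mΩ} {Z : ℝ → Ω → ℝ} (hZ : RegularProcess P F Z) (hFG : ∀ t, F t ≤ G t) :
    RegularProcess P G Z where
  adapted t ht := (hZ.adapted t ht).mono (hFG t) le_rfl
  cont := hZ.cont
  moment := hZ.moment

/-- A centred Gaussian of variance `t` is `√t` times a standard one, which makes the bound uniform
on `[0, T]`. -/
theorem lintegral_enorm_pow_gaussianReal_le (p : ℕ) {t T : ℝ≥0} (htT : t ≤ T) :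
    ∫⁻ x, ‖x‖ₑ ^ p ∂(gaussianReal 0 t) ≤
      ‖√(T : ℝ)‖ₑ ^ p * ∫⁻ x, ‖x‖ₑ ^ p ∂(gaussianReal 0 1) := by
  have hmap : gaussianReal 0 t = (gaussianReal 0 1).map (√(t : ℝ) * ·) := by
    rw [gaussianReal_map_const_mul, mul_zero, mul_one]
    congr 1
    ext
    simp
  rw [hmap, lintegral_map (by fun_prop) (by fun_prop)]
  simp only [enorm_mul, mul_pow]
  rw [lintegral_const_mul _ (by fun_prop)]
  gcongr
  rw [← ofReal_norm, ← ofReal_norm, Real.norm_of_nonneg (Real.sqrt_nonneg _),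
    Real.norm_of_nonneg (Real.sqrt_nonneg _)]
  exact ENNReal.ofReal_le_ofReal (Real.sqrt_le_sqrt (by exact_mod_cast htT))

theorem lintegral_enorm_pow_gaussianReal_lt_top (p : ℕ) :
    ∫⁻ x, ‖x‖ₑ ^ p ∂(gaussianReal 0 1) < ⊤ := by
  rcases p with _ | n
  · simp
  have h := (memLp_id_gaussianReal (μ := 0) (v := 1) ((n + 1 : ℕ) : ℝ≥0)).2
  rw [eLpNorm_lt_top_iff_lintegral_rpow_enorm_lt_top (by simp) (by simp)] at h
  have hn : (((n + 1 : ℕ) : ℝ≥0) : ENNReal).toReal = ((n + 1 : ℕ) : ℝ) := by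
    rw [ENNReal.coe_natCast, ENNReal.toReal_natCast]
  simpa only [hn, ENNReal.rpow_natCast, id] using h

theorem IsCorrelatedBrownianPair.regularProcess {Ω : Type*} {mΩ : MeasurableSpace Ω}
    {P : Measure Ω} {X Y : ℝ≥0 → Ω → ℝ} {ρ : ℝ} (h : IsCorrelatedBrownianPair X Y ρ P)
    (hX : ∀ t, Measurable (X t)) (hY : ∀ t, Measurable (Y t))
    (hXc : ∀ ω, Continuous fun t => X t ω) :
    RegularProcess P (filtrationOfPair X Y hX hY) fun t => X t.toNNReal where
  adapted t ht := by
    have h1 : Measurable[filtrationOfPair X Y hX hY t] (pastOfPair X Y t.toNNReal) :=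
      comap_measurable _
    exact (measurable_pi_apply (Sum.inl ⟨t.toNNReal, Set.mem_Iic.2 le_rfl⟩)).comp h1
  cont ω := (hXc ω).comp continuous_real_toNNReal
  moment p T := by
    refine ⟨(‖√(T.toNNReal : ℝ)‖ₑ ^ p * ∫⁻ x, ‖x‖ₑ ^ p ∂(gaussianReal 0 1)).toNNReal,
      fun t ht => ?_⟩
    rw [ENNReal.coe_toNNReal (ENNReal.mul_ne_top (by simp)
      (lintegral_enorm_pow_gaussianReal_lt_top p).ne)]
    have hlaw := h.left.hasLaw_eval t.toNNReal
    calc ∫⁻ ω, ‖X t.toNNReal ω‖ₑ ^ p ∂P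
        = ∫⁻ x, ‖x‖ₑ ^ p ∂(gaussianReal 0 t.toNNReal) := by
          rw [← hlaw.map_eq, lintegral_map (by fun_prop) (hX _)]
      _ ≤ _ := lintegral_enorm_pow_gaussianReal_le p (Real.toNNReal_mono ht.2)


/-! ### The linear equation for the mixed moment. -/

theorem mainTheorem5 {Ω : Type*} [MeasurableSpace Ω] (P : Measure Ω) [IsProbabilityMeasure P]
    (lamS μS σS μV βV γV σV ρ s₀ v₀ : ℝ)
    (Ws Wv S V : ℝ≥0 → Ω → ℝ)
    (hW : IsCorrelatedBrownianPair Ws Wv ρ P)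
    (hSV : IsSentimentVolatilitySolution lamS μS σS μV βV γV σV s₀ v₀ Ws Wv S V P) :
    (∀ t : ℝ≥0,
      Integrable (fun ω => S t ω) P ∧ Integrable (fun ω => S t ω ^ 2) P ∧
      Integrable (fun ω => S t ω ^ 3) P ∧ Integrable (fun ω => V t ω) P ∧
      Integrable (fun ω => S t ω * V t ω) P) ∧
    ∀ t : ℝ≥0,
      IntervalIntegrable (fun u : ℝ =>
        Real.exp ((γV + lamS) * (u - t)) *
          (lamS * μS * (∫ ω, V u.toNNReal ω ∂P) + σS * σV * ρ
            + (μV + βV * μS ^ 2) * (∫ ω, S u.toNNReal ω ∂P)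
            - 2 * (βV * μS) * (∫ ω, S u.toNNReal ω ^ 2 ∂P)
            + βV * (∫ ω, S u.toNNReal ω ^ 3 ∂P))) volume 0 t ∧
      ∫ ω, S t ω * V t ω ∂P =
        Real.exp (-(γV + lamS) * t) * (s₀ * v₀)
        + ∫ u in (0 : ℝ)..t,
            Real.exp ((γV + lamS) * (u - t)) *
              (lamS * μS * (∫ ω, V u.toNNReal ω ∂P) + σS * σV * ρ
                + (μV + βV * μS ^ 2) * (∫ ω, S u.toNNReal ω ∂P)
                - 2 * (βV * μS) * (∫ ω, S u.toNNReal ω ^ 2 ∂P)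
                + βV * (∫ ω, S u.toNNReal ω ^ 3 ∂P)) := by
  obtain ⟨X, hXm, hXc, hXe⟩ :=
    exists_continuous_measurable_modification hW.left.aemeasurable hW.left.cont
  obtain ⟨Y, hYm, hYc, hYe⟩ :=
    exists_continuous_measurable_modification hW.right.aemeasurable hW.right.cont
  have pair : IsCorrelatedBrownianPair X Y ρ P :=
    hW.congr hXc hYc (fun t => hXe.mono fun ω h => h t) (fun t => hYe.mono fun ω h => h t)
  have rX := pair.regularProcess hXm hYm hXc
  have rY := (pair.swap.regularProcess hYm hXm hYc).mono (filtrationOfPair_swap_le hYm hXm)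
  -- `S'` and `V'` are defined for every `ω` from the regularised noises, hence are regular; `S` and
  -- `V` agree with them at all times outside one null set.
  let S' : ℝ → Ω → ℝ := fun t ω =>
    linearSolution lamS s₀ σS (fun _ => lamS * μS) (fun u => X u.toNNReal ω) t
  have rS : RegularProcess P (filtrationOfPair X Y hXm hYm) S' :=
    (RegularProcess.of_continuous (f := fun _ => lamS * μS) continuous_const).linearSolution
      rX lamS s₀ σS
  have rconst : ∀ c : ℝ, RegularProcess P (filtrationOfPair X Y hXm hYm) fun _ _ => c :=
    fun c => RegularProcess.of_continuous (f := fun _ => c) continuous_const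
  have rdrift : RegularProcess P (filtrationOfPair X Y hXm hYm)
      fun t ω => μV + βV * (S' t ω - μS) ^ 2 :=
    (rconst μV).add (((rS.sub (rconst μS)).pow 2).const_mul βV)
  let V' : ℝ → Ω → ℝ := fun t ω =>
    linearSolution γV v₀ σV (fun u => μV + βV * (S' u ω - μS) ^ 2) (fun u => Y u.toNNReal ω) t
  have rV : RegularProcess P (filtrationOfPair X Y hXm hYm) V' :=
    rdrift.linearSolution rY γV v₀ σV
  have hS : ∀ᵐ ω ∂P, ∀ t : ℝ, 0 ≤ t → S t.toNNReal ω = S' t ω := by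
    filter_upwards [hSV.continuous_S, hSV.eq_S, hXe] with ω hc he hx t ht
    refine eq_linearSolution (x := fun u => S u.toNNReal ω) ht continuous_const (rX.cont ω)
      (hc.comp continuous_real_toNNReal) fun s hs => ?_
    rw [he, hx, Real.coe_toNNReal _ hs]
    simp only [mul_sub]
  have hV : ∀ᵐ ω ∂P, ∀ t : ℝ, 0 ≤ t → V t.toNNReal ω = V' t ω := by
    filter_upwards [hSV.continuous_V, hSV.eq_V, hYe, hS] with ω hc he hy hs t ht
    refine eq_linearSolution (x := fun u => V u.toNNReal ω) ht (rdrift.cont ω) (rY.cont ω)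
      (hc.comp continuous_real_toNNReal) fun s hs' => ?_
    rw [he, hy, Real.coe_toNNReal _ hs']
    congr 2
    refine intervalIntegral.integral_congr fun u hu => ?_
    rw [Set.uIcc_of_le hs'] at hu
    simp only [hs u hu.1]
  have hS_eq : ∀ᵐ ω ∂P, ∀ t : ℝ, 0 ≤ t →
      S' t ω = s₀ + (∫ u in (0 : ℝ)..t, lamS * (μS - S' u ω)) + σS * X t.toNNReal ω := by
    filter_upwards [hSV.eq_S, hXe, hS] with ω he hx hs t ht
    rw [← hs t ht, he, hx, Real.coe_toNNReal _ ht]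
    congr 2
    refine intervalIntegral.integral_congr fun u hu => ?_
    rw [Set.uIcc_of_le ht] at hu
    simp only [hs u hu.1]
  have hV_eq : ∀ᵐ ω ∂P, ∀ t : ℝ, 0 ≤ t →
      V' t ω = v₀ + (∫ u in (0 : ℝ)..t, (μV + βV * (S' u ω - μS) ^ 2 - γV * V' u ω)) +
        σV * Y t.toNNReal ω := by
    filter_upwards [hSV.eq_V, hYe, hS, hV] with ω he hy hs hv t ht
    rw [← hv t ht, he, hy, Real.coe_toNNReal _ ht]
    congr 2
    refine intervalIntegral.integral_congr fun u hu => ?_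
    rw [Set.uIcc_of_le ht] at hu
    simp only [hs u hu.1, hv u hu.1]
  have ra : RegularProcess P (filtrationOfPair X Y hXm hYm) fun t ω => lamS * (μS - S' t ω) :=
    ((rconst μS).sub rS).const_mul lamS
  have rb : RegularProcess P (filtrationOfPair X Y hXm hYm)
      fun t ω => μV + βV * (S' t ω - μS) ^ 2 - γV * V' t ω :=
    rdrift.sub (rV.const_mul γV)
  have hSt : ∀ t : ℝ≥0, S t =ᵐ[P] S' t := fun t => by
    filter_upwards [hS] with ω h
    rw [← h t t.2, Real.toNNReal_coe]
  have hVt : ∀ t : ℝ≥0, V t =ᵐ[P] V' t := fun t => by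
    filter_upwards [hV] with ω h
    rw [← h t t.2, Real.toNNReal_coe]
  have hpow : ∀ {f g : Ω → ℝ}, f =ᵐ[P] g → ∀ n : ℕ,
      (fun ω => f ω ^ n) =ᵐ[P] fun ω => g ω ^ n := fun h n => h.mono fun ω hω => by
    simp only [hω]
  have hSVt : ∀ t : ℝ≥0, (fun ω => S t ω * V t ω) =ᵐ[P] fun ω => S' t ω * V' t ω := fun t =>
    (hSt t).mul (hVt t)
  let G : ℝ → ℝ := fun u => lamS * μS * (∫ ω, V' u ω ∂P) + σS * σV * ρ
    + (μV + βV * μS ^ 2) * (∫ ω, S' u ω ∂P) - 2 * (βV * μS) * (∫ ω, S' u ω ^ 2 ∂P)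
    + βV * (∫ ω, S' u ω ^ 3 ∂P)
  have hG : ∀ u : ℝ, 0 ≤ u →
      lamS * μS * (∫ ω, V u.toNNReal ω ∂P) + σS * σV * ρ
        + (μV + βV * μS ^ 2) * (∫ ω, S u.toNNReal ω ∂P)
        - 2 * (βV * μS) * (∫ ω, S u.toNNReal ω ^ 2 ∂P)
        + βV * (∫ ω, S u.toNNReal ω ^ 3 ∂P) = G u := fun u hu => by
    have e1 := hSt u.toNNReal
    have e2 := hVt u.toNNReal
    rw [Real.coe_toNNReal _ hu] at e1 e2
    simp only [G]
    rw [integral_congr_ae e1, integral_congr_ae e2, integral_congr_ae (hpow e1 2),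
      integral_congr_ae (hpow e1 3)]
  have hGc : ∀ T, ContinuousOn G (Set.Icc 0 T) := fun T =>
    ((((continuousOn_const.mul (rV.continuousOn_integral T)).add continuousOn_const).add
      (continuousOn_const.mul (rS.continuousOn_integral T))).sub
      (continuousOn_const.mul ((rS.pow 2).continuousOn_integral T))).add
      (continuousOn_const.mul ((rS.pow 3).continuousOn_integral T))
  -- Expanding the square turns `S' (S' - μS) ^ 2` into the first three moments; the two terms in
  -- `S' V'` combine into the damping rate `γV + lamS`.
  have hdrift : ∀ u : ℝ, 0 ≤ u →
      ∫ ω, (lamS * (μS - S' u ω) * V' u ω +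
        S' u ω * (μV + βV * (S' u ω - μS) ^ 2 - γV * V' u ω)) ∂P + σS * σV * ρ =
      G u - (γV + lamS) * ∫ ω, S' u ω * V' u ω ∂P := fun u hu => by
    have i1 := (rV.const_mul (lamS * μS)).integrable hu
    have i2 := (rS.const_mul (μV + βV * μS ^ 2)).integrable hu
    have i3 := ((rS.pow 2).const_mul (2 * (βV * μS))).integrable hu
    have i123 := (((rV.const_mul (lamS * μS)).add (rS.const_mul (μV + βV * μS ^ 2))).sub
      ((rS.pow 2).const_mul (2 * (βV * μS)))).integrable hu
    have i4 := ((rS.pow 3).const_mul βV).integrable hu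
    have i5 := ((rS.mul rV).const_mul (γV + lamS)).integrable hu
    have e : ∀ ω, lamS * (μS - S' u ω) * V' u ω +
        S' u ω * (μV + βV * (S' u ω - μS) ^ 2 - γV * V' u ω) =
        lamS * μS * V' u ω + (μV + βV * μS ^ 2) * S' u ω - 2 * (βV * μS) * S' u ω ^ 2
          + βV * S' u ω ^ 3 - (γV + lamS) * (S' u ω * V' u ω) := fun ω => by ring
    simp only [e]
    rw [integral_sub (i123.fun_add i4) i5,
      integral_add i123 i4, integral_sub (i1.fun_add i2) i3,
      integral_add i1 i2]
    simp only [integral_const_mul, G]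
    ring
  have hmoment : ∀ t : ℝ, 0 ≤ t → ∫ ω, S' t ω * V' t ω ∂P =
      s₀ * v₀ + ∫ u in (0 : ℝ)..t, (G u - (γV + lamS) * ∫ ω, S' u ω * V' u ω ∂P) := by
    intro t ht
    have key := RegularProcess.integral_mul_eq_of_orthogonal ra rb rX rY
      (fun t _ => pair.left.integral_eval _) (fun t _ => pair.right.integral_eval _)
      (fun u t hu hut => pair.integral_sub_mul_eq_zero hXm hYm rb hu hut)
      (fun u t hu hut => pair.swap.integral_sub_mul_eq_zero hYm hXm
        (ra.mono (filtrationOfPair_swap_le hXm hYm)) hu hut)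
      (fun t ht => (pair.integral_mul _).trans (by rw [Real.coe_toNNReal _ ht]))
      s₀ v₀ σS σV ht
    -- The integral equations are used twice: at time `t` to expose drift and noise, then backwards
    -- at each `u` to fold them into `S'` and `V'` again.
    calc _ = _ := integral_congr_ae (by
          filter_upwards [hS_eq, hV_eq] with ω h1 h2
          rw [h1 t ht, h2 t ht])
      _ = _ := key
      _ = _ := by
          congr 1
          refine intervalIntegral.integral_congr fun u hu => ?_
          rw [Set.uIcc_of_le ht] at hu
          rw [← hdrift u hu.1]
          congr 1
          refine integral_congr_ae ?_
          filter_upwards [hS_eq, hV_eq] with ω h1 h2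
          rw [← h1 u hu.1, ← h2 u hu.1]
  refine ⟨fun t => ⟨(rS.integrable t.2).congr (hSt t).symm,
    ((rS.pow 2).integrable t.2).congr (hpow (hSt t) 2).symm,
    ((rS.pow 3).integrable t.2).congr (hpow (hSt t) 3).symm,
    (rV.integrable t.2).congr (hVt t).symm,
    ((rS.mul rV).integrable t.2).congr (hSVt t).symm⟩, fun t => ?_⟩
  have ht : (0 : ℝ) ≤ t := t.coe_nonneg
  have hcongr : ∀ u ∈ Set.uIcc (0 : ℝ) t, Real.exp ((γV + lamS) * (u - t)) *
          (lamS * μS * (∫ ω, V u.toNNReal ω ∂P) + σS * σV * ρ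
            + (μV + βV * μS ^ 2) * (∫ ω, S u.toNNReal ω ∂P)
            - 2 * (βV * μS) * (∫ ω, S u.toNNReal ω ^ 2 ∂P)
            + βV * (∫ ω, S u.toNNReal ω ^ 3 ∂P)) =
      Real.exp (-(γV + lamS) * t) * (Real.exp ((γV + lamS) * u) * G u) := fun u hu => by
    rw [Set.uIcc_of_le ht] at hu
    rw [hG u hu.1, ← mul_assoc, ← Real.exp_add]
    congr 2
    ring
  constructor
  · refine ContinuousOn.intervalIntegrable (ContinuousOn.congr ?_ hcongr)
    rw [Set.uIcc_of_le ht]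
    exact continuousOn_const.mul
      ((by fun_prop : Continuous fun u : ℝ => Real.exp ((γV + lamS) * u)).continuousOn.mul (hGc t))
  · rw [intervalIntegral.integral_congr hcongr, intervalIntegral.integral_const_mul, ← mul_add,
      integral_congr_ae (hSVt t)]
    exact eq_exp_mul_of_eq_add_integral ht (hGc t) ((rS.mul rV).continuousOn_integral t)
      fun s hs => hmoment s hs.1
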